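/- Let $\mathbb{K}$ be a field, $n \ge 1$, let $W=(w_1,\dots,w_n)$ be a system of weights (positive integers), and grade $\mathbb{K}[X_1,\dots,X_n]$ by giving $X_i$ the degree $w_i$; homogeneity for this grading is called $W$-homogeneity. Let $D=(d_1,\dots,d_n)$ be a system of $W$-degrees (nonnegative integers) that is strongly $W$-compatible, that is, $w_i \mid d_i$ for every $i$. Assume that $d_j \ge w_{j-1}$ for every $j \in \{2,\dots,n\}$. Let $F=(f_1,\dots,f_n)$ be a system of polynomials in $\mathbb{K}[X_1,\dots,X_n]$ with $f_i$ $W$-homogeneous of $W$-degree $d_i$, and assume that $F$ is in simultaneous Noether position for $X_1 > \dots > X_n$: for every $i \in \{1,\dots,n\}$, with $I_i = \langle f_1,\dots,f_i\rangle$, the images of $X_1,\dots,X_i$ in $\mathbb{K}[X_1,\dots,X_n]/I_i$ are integral over $\mathbb{K}[X_{i+1},\dots,X_n]$, and $\mathbb{K}[X_{i+1},\dots,X_n]\cap I_i = 0$. The $W$-degree of regularity $\mathrm{d}_{\mathrm{reg},W}(F)$ is the highest degree reached in a run of the (Matrix-)F5 algorithm that computes a Gröbner basis of the homogeneous system $\big(f_i(t_1^{w_1},\dots,t_n^{w_n})\big)_{1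 \le i \le n}$ for the graded reverse lexicographic order with $t_1 > \dots > t_n$, i.e. the smallest degree $d$ such that the algorithm, run degree by degree up to degree $d$, has processed all the input polynomials and has computed a Gröbner basis of the ideal that they generate. Here, on homogeneous input $(g_1,\dots,g_m)$, the matrix of index $i$ in degree $e$ consists of the rows of the matrix of index $i-1$ in degree $e$ (no rows for index $0$) and of the rows $u\,g_i$ for all monomials $u$ of degree $e-\deg g_i$ that are not the leading monomial of a nonzero element of the row space of the matrix of index $i-1$ in degree $e-\deg g_i$; the polynomials computed in degree $e$ are those in the row space of the matrix of index $m$ in degree $e$. Then the $W$-degree of regularity of $F$ exists and satisfies $$\mathrm{d}_{\mathrm{reg},W}(F) \;\le\; \sum_{i=1}^{n} (d_i - w_i) + w_n .$$ -/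

import Mathlib

open scoped BigOperators

/-! ### The graded reverse lexicographic order -/

/-- Type synonym for the exponent vectors of monomials in `X_1, …, X_n`, to be ordered by the
graded reverse lexicographic order with `X_1 > X_2 > … > X_n`. -/
def GRevLex (n : ℕ) : Type := Fin n →₀ ℕ

namespace GRevLex

variable {n : ℕ}

noncomputable instance : AddCommMonoid (GRevLex n) := inferInstanceAs (AddCommMonoid (Fin n →₀ ℕ))

/-- The relation `a < b` of the graded reverse lexicographic order: the total degree of `a` is
smaller than that of `b`, or the total degrees agree and, at the largest index where the exponents
differ, the exponent of `a` is larger. -/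
def Rel (a b : Fin n →₀ ℕ) : Prop :=
  a.degree < b.degree ∨ (a.degree = b.degree ∧ ∃ i, b i < a i ∧ ∀ j, i < j → a j = b j)

/-- An auxiliary key by which exponent vectors can be compared lexicographically: the total
degree, followed by the partial sums `∑_{j < i} a_j` for decreasing `i`. -/
noncomputable def key (a : Fin n →₀ ℕ) : ℕ ×ₗ Lex (Fin n → ℕ) :=
  toLex (a.degree, toLex fun k => ∑ j with j < k.rev, a j)

lemma degree_eq_split (a : Fin n →₀ ℕ) (i : Fin n) :
    a.degree = (∑ j with j < i, a j) + (a i + ∑ j with i < j, a j) := by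
  have h1 : a.degree = ∑ j, a j := Finsupp.degree_eq_sum a
  rw [h1, ← Finset.sum_filter_add_sum_filter_not Finset.univ (fun j => j < i)]
  congr 1
  have : (Finset.univ.filter fun j => ¬ j < i) = insert i (Finset.univ.filter fun j => i < j) := by
    ext j
    simp only [Finset.mem_filter, Finset.mem_univ, true_and, Finset.mem_insert, not_lt]
    rw [le_iff_eq_or_lt, eq_comm]
  rw [this, Finset.sum_insert (by simp)]

lemma key_lt_of_rel {a b : Fin n →₀ ℕ} (h : Rel a b) : key a < key b := by
  rw [key, key, Prod.Lex.toLex_lt_toLex]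
  rcases h with h | ⟨h, i, hi, hij⟩
  · exact Or.inl h
  · refine Or.inr ⟨h, i.rev, fun k hk => ?_, ?_⟩
    · change (∑ j with j < k.rev, a j) = ∑ j with j < k.rev, b j
      have hk' : i < k.rev := by rwa [Fin.lt_rev_iff]
      have e1 := degree_eq_split a k.rev
      have e2 := degree_eq_split b k.rev
      have e3 : (∑ j with k.rev < j, a j) = ∑ j with k.rev < j, b j :=
        Finset.sum_congr rfl fun j hj => hij j (hk'.trans (by simpa using hj))
      have e4 := hij _ hk'
      omega
    · change (∑ j with j < i.rev.rev, a j) < ∑ j with j < i.rev.rev, b j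
      rw [Fin.rev_rev]
      have e1 := degree_eq_split a i
      have e2 := degree_eq_split b i
      have e3 : (∑ j with i < j, a j) = ∑ j with i < j, b j :=
        Finset.sum_congr rfl fun j hj => hij j (by simpa using hj)
      omega

lemma rel_trichotomy (a b : Fin n →₀ ℕ) : Rel a b ∨ a = b ∨ Rel b a := by
  by_cases hab : a = b
  · exact Or.inr (Or.inl hab)
  rcases lt_trichotomy a.degree b.degree with h | h | h
  · exact Or.inl (Or.inl h)
  · have hne : (Finset.univ.filter fun i => a i ≠ b i).Nonempty := by
      by_contra hemp
      refine hab (Finsupp.ext fun i => ?_)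
      by_contra hi
      exact hemp ⟨i, by simpa using hi⟩
    obtain ⟨i, hi, hmax⟩ := Finset.exists_max_image _ id hne
    have hi' : a i ≠ b i := by simpa using hi
    have hj : ∀ j, i < j → a j = b j := by
      intro j hij
      by_contra hne'
      exact absurd (hmax j (by simpa using hne')) (not_le.mpr hij)
    rcases lt_or_gt_of_ne hi' with hlt | hlt
    · exact Or.inr (Or.inr (Or.inr ⟨h.symm, i, hlt, fun j hij => (hj j hij).symm⟩))
    · exact Or.inl (Or.inr ⟨h, i, hlt, hj⟩)
  · exact Or.inr (Or.inr (Or.inl h))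

lemma key_injective : Function.Injective (key (n := n)) := by
  intro a b h
  rcases rel_trichotomy a b with h' | h' | h'
  · exact absurd h (key_lt_of_rel h').ne
  · exact h'
  · exact absurd h (key_lt_of_rel h').ne'

lemma key_lt_iff {a b : Fin n →₀ ℕ} : key a < key b ↔ Rel a b := by
  refine ⟨fun h => ?_, key_lt_of_rel⟩
  rcases rel_trichotomy a b with h' | h' | h'
  · exact h'
  · exact absurd (h' ▸ h) (lt_irrefl _)
  · exact absurd h (key_lt_of_rel h').asymm

noncomputable instance : LinearOrder (GRevLex n) :=
  LinearOrder.lift' (key (n := n)) key_injective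

lemma lt_iff {a b : GRevLex n} : a < b ↔ Rel (n := n) a b := key_lt_iff

lemma rel_add {a b : Fin n →₀ ℕ} (h : Rel a b) (c : Fin n →₀ ℕ) : Rel (c + a) (c + b) := by
  rcases h with h | ⟨h, i, hi, hij⟩
  · exact Or.inl (by simpa using h)
  · exact Or.inr ⟨by simpa using h, i, by simpa using hi, fun j hj => by simp [hij j hj]⟩

instance : IsOrderedAddMonoid (GRevLex n) where
  add_le_add_left a b h c := by
    rcases h.eq_or_lt with rfl | h
    · exact le_rfl
    · rw [add_comm a, add_comm b]
      exact (lt_iff.2 (rel_add (lt_iff.1 h) c)).le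

instance : WellFoundedLT (GRevLex n) :=
  ⟨InvImage.wf (key (n := n)) (wellFounded_lt (α := ℕ ×ₗ Lex (Fin n → ℕ)))⟩

end GRevLex

/-- The graded reverse lexicographic monomial order on the monomials in `X_1 > X_2 > … > X_n`. -/
noncomputable def grevlex (n : ℕ) : MonomialOrder (Fin n) where
  syn := GRevLex n
  toSyn := { Equiv.refl (Fin n →₀ ℕ) with map_add' := fun _ _ => rfl }
  toSyn_monotone a b h := by
    by_contra hlt
    rcases GRevLex.lt_iff.1 (not_le.1 hlt) with hd | ⟨hd, i, hi, -⟩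
    · exact absurd (Finsupp.degree_mono h) (not_le.2 hd)
    · have hs : a.degree < b.degree := by
        rw [Finsupp.degree_eq_sum, Finsupp.degree_eq_sum]
        exact Finset.sum_lt_sum (fun j _ => h j) ⟨i, Finset.mem_univ i, hi⟩
      exact absurd hd hs.ne'

/-- The order `grevlex n` is the graded reverse lexicographic order. -/
lemma grevlex_lt_iff {n : ℕ} {a b : Fin n →₀ ℕ} :
    (grevlex n).toSyn a < (grevlex n).toSyn b ↔
      a.degree < b.degree ∨
        (a.degree = b.degree ∧ ∃ i, b i < a i ∧ ∀ j, i < j → a j = b j) :=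
  GRevLex.lt_iff

/-! ### Gröbner bases and the Matrix-F5 algorithm -/

section F5

open MvPolynomial

variable {n m : ℕ} {K : Type*} [Field K]

/-- The leading monomials of the nonzero elements of a set of polynomials. -/
def leadingMonomials (mo : MonomialOrder (Fin n)) (G : Set (MvPolynomial (Fin n) K)) :
    Set (Fin n →₀ ℕ) :=
  {a | ∃ g ∈ G, g ≠ 0 ∧ mo.degree g = a}

/-- `G` is a Gröbner basis of the ideal `I` (possibly redundant, possibly infinite): `G ⊆ I` and
the leading monomial of every nonzero element of `I` is divisible by the leading monomial of a
nonzero element of `G`. -/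
def IsGroebnerBasis (mo : MonomialOrder (Fin n)) (G : Set (MvPolynomial (Fin n) K))
    (I : Ideal (MvPolynomial (Fin n) K)) : Prop :=
  G ⊆ I ∧ ∀ a ∈ leadingMonomials mo (I : Set (MvPolynomial (Fin n) K)),
    ∃ b ∈ leadingMonomials mo G, b ≤ a

/-- The rows of the matrices built by the Matrix-F5 algorithm on the homogeneous polynomials
`f_1, …, f_m`. The matrix of index `i` in degree `d` has the rows of the matrix of index `i - 1`
in degree `d`, and the rows `u * f_i` for all monomials `u` of degree `d - deg f_i` that pass the
F5 criterion: `u` is not the leading monomial of a row of the echelon form of the matrix of index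
`i - 1` in degree `d - deg f_i`. The leading monomials of the rows of an echelon form are the
leading monomials of the nonzero elements of the row space. -/
noncomputable def matrixF5Rows (mo : MonomialOrder (Fin n))
    (f : Fin m → MvPolynomial (Fin n) K) : ℕ → ℕ → Set (MvPolynomial (Fin n) K)
  | 0, _ => ∅
  | i + 1, d => matrixF5Rows mo f i d ∪
      {p | ∃ (hi : i < m) (u : Fin n →₀ ℕ),
        u.degree + (f ⟨i, hi⟩).totalDegree = d ∧
        u ∉ leadingMonomials mo (Submodule.span K (matrixF5Rows mo f i u.degree) :
          Set (MvPolynomial (Fin n) K)) ∧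
        p = monomial u 1 * f ⟨i, hi⟩}

/-- The polynomials computed by a run of Matrix-F5 on `f_1, …, f_m` up to degree `D`: the elements
of the row spaces of the final matrices in the degrees `d ≤ D`. -/
def matrixF5Output (mo : MonomialOrder (Fin n)) (f : Fin m → MvPolynomial (Fin n) K) (D : ℕ) :
    Set (MvPolynomial (Fin n) K) :=
  {p | ∃ d ≤ D, p ∈ Submodule.span K (matrixF5Rows mo f m d)}

/-- The run of Matrix-F5 on `f_1, …, f_m` up to degree `D` is complete: it has processed all the
input polynomials and it has computed a Gröbner basis of the ideal that they generate. -/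
def MatrixF5Complete (mo : MonomialOrder (Fin n)) (f : Fin m → MvPolynomial (Fin n) K)
    (D : ℕ) : Prop :=
  (∀ i, (f i).totalDegree ≤ D) ∧
    IsGroebnerBasis mo (matrixF5Output mo f D) (Ideal.span (Set.range f))

/-- `D` is the highest degree reached in a run of (Matrix-)F5, proceeding degree by degree, that
computes a Gröbner basis of the ideal generated by `f_1, …, f_m`. -/
def IsHighestDegreeF5 (mo : MonomialOrder (Fin n)) (f : Fin m → MvPolynomial (Fin n) K)
    (D : ℕ) : Prop :=
  IsLeast {D | MatrixF5Complete mo f D} D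

end F5

/-! ### Weighted homogeneous systems -/

section Weighted

open MvPolynomial

variable {n m : ℕ} {K : Type*} [Field K]

/-- The morphism `f ↦ f(t_1 ^ w_1, …, t_n ^ w_n)`. -/
noncomputable def homW (W : Fin n → ℕ) :
    MvPolynomial (Fin n) K →ₐ[K] MvPolynomial (Fin n) K :=
  aeval fun i => X i ^ W i

/-- `r` is the `W`-degree of regularity of the system `F`: the highest degree reached in a run of
F5 computing a GRevLex Gröbner basis of the system `homW W F`. -/
def IsWDegreeOfRegularity (W : Fin n → ℕ) (F : Fin m → MvPolynomial (Fin n) K) (r : ℕ) : Prop :=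
  IsHighestDegreeF5 (grevlex n) (fun i => homW W (F i)) r

/-- A system `D` of `n` degrees is strongly `W`-compatible if `w_i` divides `d_i` for all `i`. -/
def IsStronglyCompatible (W D : Fin n → ℕ) : Prop := ∀ i, W i ∣ D i

/-- The system `f_1, …, f_m` is in Noether position with respect to the variables `X_1, …, X_m`:
with `I` the ideal that it generates, the images of `X_1, …, X_m` in `K[X_1, …, X_n] / I` are
integral over `K[X_{m+1}, …, X_n]`, and `K[X_{m+1}, …, X_n] ∩ I = 0`. -/
def IsInNoetherPosition (F : Fin m → MvPolynomial (Fin n) K) : Prop :=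
  (∀ k : Fin n, (k : ℕ) < m →
    IsIntegral (supported K {l : Fin n | m ≤ (l : ℕ)})
      (Ideal.Quotient.mk (Ideal.span (Set.range F)) (X k))) ∧
  ∀ p ∈ supported K {l : Fin n | m ≤ (l : ℕ)}, p ∈ Ideal.span (Set.range F) → p = 0

/-- The system `f_1, …, f_m` is in simultaneous Noether position for the variable ordering
`X_1 > … > X_n`: for all `1 ≤ i ≤ m`, the system `f_1, …, f_i` is in Noether position with respect
to the variables `X_1, …, X_i`. -/
def IsInSimultaneousNoetherPosition (F : Fin m → MvPolynomial (Fin n) K) : Prop :=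
  ∀ (i : ℕ) (hi : i ≤ m), 1 ≤ i → IsInNoetherPosition fun j : Fin i => F (Fin.castLE hi j)

end Weighted

/-! A Hilbert function argument bounds degrees in slices of the system, and the graded reverse
lexicographic order transfers the bounds to leading monomials.

Let δ_i = ∑_{j ≤ i} (d_j - w_j), and let J be generated by f_1, …, f_i and X_{i+2}, …, X_n.
Inductively, x = X_{i+1} is regular modulo J and R/(J + (x)) vanishes above degree δ_i. So the
Hilbert function of R/J has period w_{i+1} in degrees above δ_i - w_{i+1}. As w_{i+1} divides
d_{i+1}, multiplication by f = f_{i+1} joins pieces of equal dimension there. Noether position makes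
it onto in large degrees, hence injective there, and then everywhere by cancelling powers of x
(`regularModulo_of_large_degrees`). Injectivity in turn makes it onto from every degree above δ_i -
w_{i+1}, so R/(J + (f)) vanishes above δ_{i+1} (`mem_sup_span_singleton_of_degree_lt`).

The F5 criterion discards only redundant rows, so the row spaces are the graded pieces of the ideals
(`mem_span_matrixF5Rows`), and it suffices to bound the degrees of the generators and of the minimal
leading monomials. The latter have the form t^{Wc} (`scaleExponent_div_mem_leadingMonomials`). If
X_k is the last variable in X^c, then X^c / X_k has weight at most δ_k; otherwise it lies in (f_1,
…, f_k, X_{k+1}, …, X_n) and yields a smaller leading monomial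
(`scaleExponent_mem_leadingMonomials`). The resulting bound δ_k + w_k is nondecreasing in k because
d_{k+1} ≥ w_k. -/

/-! ### Regular elements and Hilbert functions of graded quotients -/

section GradedRegularity

/-- Multiplication by `f` is injective modulo the ideal `J`. -/
def RegularModulo {R : Type*} [CommRing R] (f : R) (J : Ideal R) : Prop :=
  ∀ p, f * p ∈ J → p ∈ J

lemma Ideal.mem_sup_span_singleton {R : Type*} [CommRing R] {J : Ideal R} {f p : R} :
    p ∈ J ⊔ Ideal.span {f} ↔ ∃ q, p - f * q ∈ J := by
  rw [Submodule.mem_sup]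
  constructor
  · rintro ⟨y, hy, z, hz, rfl⟩
    obtain ⟨q, rfl⟩ := Ideal.mem_span_singleton'.1 hz
    exact ⟨q, by rwa [mul_comm, add_sub_cancel_right]⟩
  · rintro ⟨q, hq⟩
    exact ⟨_, hq, f * q, Ideal.mem_span_singleton.2 (dvd_mul_right _ _), sub_add_cancel _ _⟩

/-- If `x, f` is a regular sequence modulo `J`, then `x` is regular modulo `J + (f)`. -/
lemma RegularModulo.sup_span_singleton {R : Type*} [CommRing R] {J : Ideal R} {x f : R}
    (hx : RegularModulo x J) (hf : RegularModulo f (J ⊔ Ideal.span {x})) :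
    RegularModulo x (J ⊔ Ideal.span {f}) := by
  intro b hb
  obtain ⟨c, hc⟩ := Ideal.mem_sup_span_singleton.1 hb
  have hfc : f * c ∈ J ⊔ Ideal.span {x} :=
    Ideal.mem_sup_span_singleton.2 ⟨b, by simpa using J.neg_mem hc⟩
  obtain ⟨c', hc'⟩ := Ideal.mem_sup_span_singleton.1 (hf c hfc)
  -- Modulo `J`, `x * b = f * c` and `c = x * c'`, so `x` kills `b - f * c'`.
  refine Ideal.mem_sup_span_singleton.2 ⟨c', hx _ ?_⟩
  have := J.add_mem hc (J.mul_mem_left f hc')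
  convert this using 1
  ring

lemma RegularModulo.pow {R : Type*} [CommRing R] {J : Ideal R} {x : R}
    (hx : RegularModulo x J) (c : ℕ) : RegularModulo (x ^ c) J := by
  induction c with
  | zero => intro p hp; simpa using hp
  | succ c ih => intro p hp; exact hx _ (ih _ (by rwa [← mul_assoc, ← pow_succ]))

variable {K R : Type*} [Field K] [CommRing R] [Algebra K R] (𝒜 : ℕ → Submodule K R)

/-- The image of the degree `d` part in the quotient by `J`. -/
noncomputable def quotientPiece (J : Ideal R) (d : ℕ) : Submodule K (R ⧸ J) :=
  (𝒜 d).map (Ideal.Quotient.mkₐ K J).toLinearMap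

instance (J : Ideal R) (d : ℕ) [FiniteDimensional K (𝒜 d)] :
    FiniteDimensional K (quotientPiece 𝒜 J d) := by
  unfold quotientPiece; infer_instance

lemma mk_mem_quotientPiece {J : Ideal R} {d : ℕ} {p : R} (hp : p ∈ 𝒜 d) :
    Ideal.Quotient.mk J p ∈ quotientPiece 𝒜 J d := ⟨p, hp, rfl⟩

lemma exists_of_mem_quotientPiece {J : Ideal R} {d : ℕ} {y : R ⧸ J}
    (hy : y ∈ quotientPiece 𝒜 J d) : ∃ p ∈ 𝒜 d, Ideal.Quotient.mk J p = y := hy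

variable [GradedAlgebra 𝒜]

open DirectSum

/-- A homogeneous element of `J + (f)` is in `J`, or is congruent modulo `J` to a multiple of `f` by
a homogeneous element. -/
lemma exists_homogeneous_cofactor {J : Ideal R} (hJ : J.IsHomogeneous 𝒜) {f p : R} {e d : ℕ}
    (hf : f ∈ 𝒜 e) (hp : p ∈ 𝒜 d) (h : p ∈ J ⊔ Ideal.span {f}) :
    p ∈ J ∨ ∃ d' q, d' + e = d ∧ q ∈ 𝒜 d' ∧ p - f * q ∈ J := by
  obtain ⟨q, hq⟩ := Ideal.mem_sup_span_singleton.1 h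
  have h1 := hJ d hq
  rw [decompose_sub, DFinsupp.sub_apply, AddSubgroupClass.coe_sub,
    decompose_of_mem_same 𝒜 hp] at h1
  by_cases hed : e ≤ d
  · refine Or.inr ⟨d - e, decompose 𝒜 q (d - e), Nat.sub_add_cancel hed, SetLike.coe_mem _, ?_⟩
    rwa [coe_decompose_mul_of_left_mem_of_le 𝒜 hf hed] at h1
  · rw [coe_decompose_mul_of_left_mem_of_not_le 𝒜 hf hed, sub_zero] at h1
    exact Or.inl h1

lemma mem_of_forall_decompose_mem {J : Ideal R} {p : R}
    (h : ∀ d, (decompose 𝒜 p d : R) ∈ J) : p ∈ J := by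
  classical
  rw [← sum_support_decompose 𝒜 p]
  exact J.sum_mem fun d _ => h d

lemma regularModulo_of_homogeneous {J : Ideal R} (hJ : J.IsHomogeneous 𝒜) {f : R} {e : ℕ}
    (hf : f ∈ 𝒜 e) (h : ∀ d, ∀ p ∈ 𝒜 d, f * p ∈ J → p ∈ J) : RegularModulo f J := by
  intro p hp
  refine mem_of_forall_decompose_mem 𝒜 fun d => h d _ (SetLike.coe_mem _) ?_
  have := hJ (e + d) hp
  rwa [coe_decompose_mul_add_of_left_mem 𝒜 hf] at this

/-- If `x, f` is a homogeneous regular sequence modulo `J` and `x` has positive degree, then `f` is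
regular modulo `J`. -/
lemma RegularModulo.of_sup_span_singleton {J : Ideal R} (hJ : J.IsHomogeneous 𝒜) {x f : R}
    {w e : ℕ} (hw : 0 < w) (hxw : x ∈ 𝒜 w) (hfe : f ∈ 𝒜 e)
    (hx : RegularModulo x J) (hf : RegularModulo f (J ⊔ Ideal.span {x})) : RegularModulo f J := by
  refine regularModulo_of_homogeneous 𝒜 hJ hfe fun d => ?_
  induction d using Nat.strong_induction_on with
  | _ d ih =>
    intro p hp hfp
    -- Modulo `J`, `p = x * q`; cancelling `x` leaves `f * q ∈ J` with `q` of smaller degree, since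
    -- `w > 0`.
    rcases exists_homogeneous_cofactor 𝒜 hJ hxw hp (hf p (Ideal.mem_sup_left hfp)) with
      h | ⟨d', q, rfl, hq, hpq⟩
    · exact h
    · have h1 : x * (f * q) ∈ J := by
        have := J.sub_mem hfp (J.mul_mem_left f hpq)
        convert this using 1
        ring
      have h2 := ih d' (by omega) q hq (hx _ h1)
      have := J.add_mem hpq (J.mul_mem_left x h2)
      simpa using this

lemma map_mulLeft_quotientPiece_le {J : Ideal R} {f : R} {e d : ℕ} (hf : f ∈ 𝒜 e) :
    (quotientPiece 𝒜 J d).map (LinearMap.mulLeft K (Ideal.Quotient.mk J f)) ≤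
      quotientPiece 𝒜 J (e + d) := by
  rintro _ ⟨_, ⟨p, hp, rfl⟩, rfl⟩
  exact ⟨f * p, SetLike.mul_mem_graded hf hp, by simp⟩

lemma injective_mulLeft_mk {J : Ideal R} {f : R} (hf : RegularModulo f J) :
    Function.Injective (LinearMap.mulLeft K (Ideal.Quotient.mk J f)) := by
  rw [injective_iff_map_eq_zero]
  intro y hy
  obtain ⟨p, rfl⟩ := Ideal.Quotient.mk_surjective y
  rw [LinearMap.mulLeft_apply, ← map_mul, Ideal.Quotient.eq_zero_iff_mem] at hy
  exact Ideal.Quotient.eq_zero_iff_mem.2 (hf p hy)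

/-- Above the top degree of the quotient by `J + (x)`, multiplication by powers of `x` is surjective
between graded pieces of the quotient by `J`. -/
lemma exists_pow_cofactor {J : Ideal R} (hJ : J.IsHomogeneous 𝒜) {x : R} {w : ℕ} (hxw : x ∈ 𝒜 w)
    {δ : ℤ} (hδ : ∀ d : ℕ, δ < d → ∀ p ∈ 𝒜 d, p ∈ J ⊔ Ideal.span {x}) (c d : ℕ)
    (hd : δ < d + w) : ∀ p ∈ 𝒜 (c * w + d), ∃ q ∈ 𝒜 d, p - x ^ c * q ∈ J := by
  induction c with
  | zero => intro p hp; exact ⟨p, by simpa using hp, by simp⟩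
  | succ c ih =>
    intro p hp
    have hlt : δ < (((c + 1) * w + d : ℕ) : ℤ) := by
      have : (0 : ℤ) ≤ c * w := by positivity
      push_cast
      linarith
    rcases exists_homogeneous_cofactor 𝒜 hJ hxw hp (hδ _ hlt p hp) with
      h | ⟨d', q, hd', hq, hpq⟩
    · exact ⟨0, zero_mem _, by simpa using h⟩
    · obtain rfl : d' = c * w + d := by
        have : (c + 1) * w = c * w + w := by ring
        omega
      obtain ⟨r, hr, hqr⟩ := ih q hq
      refine ⟨r, hr, ?_⟩
      have := J.add_mem hpq (J.mul_mem_left x hqr)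
      convert this using 1
      ring

/-- Multiplication by `x ^ c` is bijective between these pieces: injective by regularity, onto by
`exists_pow_cofactor`. Only the target degrees, from `d + w` on, have to exceed `δ`. -/
lemma finrank_quotientPiece_add {J : Ideal R} (hJ : J.IsHomogeneous 𝒜)
    {x : R} {w : ℕ} (hxw : x ∈ 𝒜 w) (hx : RegularModulo x J)
    {δ : ℤ} (hδ : ∀ d : ℕ, δ < d → ∀ p ∈ 𝒜 d, p ∈ J ⊔ Ideal.span {x}) (c d : ℕ)
    (hd : δ < d + w) :
    Module.finrank K (quotientPiece 𝒜 J (c * w + d)) =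
      Module.finrank K (quotientPiece 𝒜 J d) := by
  have hxc : x ^ c ∈ 𝒜 (c * w) := SetLike.pow_mem_graded c hxw
  have hmap : (quotientPiece 𝒜 J d).map (LinearMap.mulLeft K (Ideal.Quotient.mk J (x ^ c))) =
      quotientPiece 𝒜 J (c * w + d) := by
    refine le_antisymm (map_mulLeft_quotientPiece_le 𝒜 hxc) fun y hy => ?_
    obtain ⟨p, hp, rfl⟩ := exists_of_mem_quotientPiece 𝒜 hy
    obtain ⟨q, hq, hpq⟩ := exists_pow_cofactor 𝒜 hJ hxw hδ c d hd p hp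
    refine ⟨_, mk_mem_quotientPiece 𝒜 hq, ?_⟩
    rw [LinearMap.mulLeft_apply, ← map_mul]
    exact (Ideal.Quotient.eq.2 hpq).symm
  rw [← hmap]
  exact (LinearEquiv.finrank_eq (Submodule.equivMapOfInjective _
    (injective_mulLeft_mk (K := K) (hx.pow c)) (quotientPiece 𝒜 J d))).symm

/-- If `x` is regular modulo `J` and some degree piece of multiplication by `f` is onto between
pieces of equal dimension, then it is also injective. -/
lemma mem_of_mul_mem_of_surjective {J : Ideal R} (hJ : J.IsHomogeneous 𝒜) {f : R} {e d : ℕ}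
    [FiniteDimensional K (𝒜 d)] (hf : f ∈ 𝒜 e)
    (hdim : Module.finrank K (quotientPiece 𝒜 J (e + d)) =
      Module.finrank K (quotientPiece 𝒜 J d))
    (hsurj : ∀ p ∈ 𝒜 (e + d), p ∈ J ⊔ Ideal.span {f}) :
    ∀ p ∈ 𝒜 d, f * p ∈ J → p ∈ J := by
  intro p hp hfp
  set g := (LinearMap.mulLeft K (Ideal.Quotient.mk J f)).domRestrict (quotientPiece 𝒜 J d) with hg
  have hrange : LinearMap.range g = quotientPiece 𝒜 J (e + d) := by
    rw [hg, LinearMap.range_domRestrict]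
    refine le_antisymm (map_mulLeft_quotientPiece_le 𝒜 hf) fun y hy => ?_
    obtain ⟨r, hr, rfl⟩ := exists_of_mem_quotientPiece 𝒜 hy
    rcases exists_homogeneous_cofactor 𝒜 hJ hf hr (hsurj r hr) with h | ⟨d', q, hd', hq, hrq⟩
    · rw [Ideal.Quotient.eq_zero_iff_mem.2 h]
      exact zero_mem _
    · obtain rfl : d' = d := by omega
      refine ⟨_, mk_mem_quotientPiece 𝒜 hq, ?_⟩
      rw [LinearMap.mulLeft_apply, ← map_mul]
      exact (Ideal.Quotient.eq.2 hrq).symm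
  have hker : LinearMap.ker g = ⊥ := by
    have := LinearMap.finrank_range_add_finrank_ker g
    rw [hrange] at this
    exact Submodule.finrank_eq_zero.1 (by omega)
  have h0 : g ⟨_, mk_mem_quotientPiece 𝒜 hp⟩ = 0 := by
    change Ideal.Quotient.mk J f * Ideal.Quotient.mk J p = 0
    rw [← map_mul]
    exact Ideal.Quotient.eq_zero_iff_mem.2 hfp
  have h1 := LinearMap.ker_eq_bot'.1 hker _ h0
  exact Ideal.Quotient.eq_zero_iff_mem.1 (congrArg Subtype.val h1)

/-- Let `x` be regular modulo `J`, and let the quotient by `J + (f)` vanish in large degrees, where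
the degree of `f` is a multiple of that of `x`. Then `f` is regular modulo `J`. -/
lemma regularModulo_of_large_degrees [∀ d, FiniteDimensional K (𝒜 d)] {J : Ideal R}
    (hJ : J.IsHomogeneous 𝒜) {x f : R} {w c : ℕ} (hw : 0 < w) (hxw : x ∈ 𝒜 w)
    (hf : f ∈ 𝒜 (c * w)) (hx : RegularModulo x J)
    {δ : ℤ} (hδ : ∀ d : ℕ, δ < d → ∀ p ∈ 𝒜 d, p ∈ J ⊔ Ideal.span {x})
    {N : ℕ} (hN : ∀ d : ℕ, N ≤ d → ∀ p ∈ 𝒜 d, p ∈ J ⊔ Ideal.span {f}) : RegularModulo f J := by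
  refine regularModulo_of_homogeneous 𝒜 hJ hf fun d p hp hfp => ?_
  -- Multiplying by `x ^ k` moves `p` to a degree where the Hilbert function is periodic and
  -- multiplication by `f` is onto; `x ^ k` is cancelled at the end.
  set k := N + δ.toNat with hk
  have hkw : k ≤ k * w := Nat.le_mul_of_pos_right k hw
  have hdeg : δ < ((k * w + d : ℕ) : ℤ) + w := by omega
  refine hx.pow k p (mem_of_mul_mem_of_surjective 𝒜 hJ hf
    (finrank_quotientPiece_add 𝒜 hJ hxw hx hδ c (k * w + d) hdeg)
    (fun r hr => hN _ (by omega) r hr) _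
    (SetLike.mul_mem_graded (SetLike.pow_mem_graded k hxw) hp) ?_)
  have := J.mul_mem_left (x ^ k) hfp
  convert this using 1
  ring

/-- Let `x` and `f` be regular modulo `J`, where the degree of `f` is a multiple of that of `x`. If
the quotient by `J + (x)` vanishes in the degrees above `δ`, then the quotient by `J + (f)` vanishes
in the degrees above `δ + deg f - deg x`. -/
lemma mem_sup_span_singleton_of_degree_lt [∀ d, FiniteDimensional K (𝒜 d)] {J : Ideal R}
    (hJ : J.IsHomogeneous 𝒜) {x f : R} {w c : ℕ} (hw : 0 < w) (hxw : x ∈ 𝒜 w)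
    (hf : f ∈ 𝒜 (c * w)) (hx : RegularModulo x J) (hfJ : RegularModulo f J)
    {δ : ℤ} (hδ : ∀ d : ℕ, δ < d → ∀ p ∈ 𝒜 d, p ∈ J ⊔ Ideal.span {x}) :
    ∀ d : ℕ, δ + ((c * w : ℕ) - w : ℤ) < d → ∀ p ∈ 𝒜 d, p ∈ J ⊔ Ideal.span {f} := by
  intro d hd p hp
  rcases le_or_gt (c * w) d with hcd | hcd
  · obtain ⟨s, rfl⟩ := Nat.exists_eq_add_of_le hcd
    have hdim := finrank_quotientPiece_add 𝒜 hJ hxw hx hδ c s (by omega)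
    have hmap : (quotientPiece 𝒜 J s).map (LinearMap.mulLeft K (Ideal.Quotient.mk J f)) =
        quotientPiece 𝒜 J (c * w + s) := by
      refine Submodule.eq_of_le_of_finrank_eq (map_mulLeft_quotientPiece_le 𝒜 hf) ?_
      rw [hdim]
      exact (LinearEquiv.finrank_eq (Submodule.equivMapOfInjective _
        (injective_mulLeft_mk (K := K) hfJ) (quotientPiece 𝒜 J s))).symm
    have hmem := mk_mem_quotientPiece 𝒜 (J := J) hp
    rw [← hmap] at hmem
    obtain ⟨_, ⟨q, -, rfl⟩, hq⟩ := hmem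
    refine Ideal.mem_sup_span_singleton.2 ⟨q, Ideal.Quotient.eq.1 ?_⟩
    rw [← hq]
    simp
  -- Below the degree of `f`, `p` must already be in `J`. Here `p = x ^ (d / w) * q` modulo `J` with
  -- `q` of degree `d % w`, which still exceeds `δ`; so `q ∈ J + (x)`, and `q ∈ J` because its
  -- degree is less than `w`.
  · refine Ideal.mem_sup_left ?_
    have hsd : d / w * w + d % w = d := Nat.div_add_mod' d w
    have hk : d / w + 1 ≤ c := (Nat.div_lt_iff_lt_mul hw).2 hcd
    have hkw : d / w * w + w ≤ c * w := by
      rw [← Nat.succ_mul]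
      exact Nat.mul_le_mul_right w hk
    have hs : d % w < w := Nat.mod_lt d hw
    have hδs : δ < (d % w : ℕ) := by omega
    rw [← hsd] at hp
    obtain ⟨q, hq, hpq⟩ := exists_pow_cofactor 𝒜 hJ hxw hδ (d / w) (d % w) (by omega) p hp
    have hqJ : q ∈ J := by
      rcases exists_homogeneous_cofactor 𝒜 hJ hxw hq (hδ _ hδs q hq) with h | ⟨d', _, hd', -⟩
      · exact h
      · omega
    simpa using J.add_mem hpq (J.mul_mem_left (x ^ (d / w)) hqJ)

end GradedRegularity

/-! ### Consequences of Noether position in large degrees -/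

section NoetherPosition

open MvPolynomial

attribute [local instance] MvPolynomial.weightedGradedAlgebra

variable {K : Type*} [Field K] {m N : ℕ}

lemma finiteDimensional_weightedHomogeneousSubmodule {W : Fin N → ℕ} (hW : ∀ i, 0 < W i) (d : ℕ) :
    FiniteDimensional K (weightedHomogeneousSubmodule K W d) :=
  Module.Finite.iff_fg.2 (weightedHomogeneousSubmodule_fg K W (fun i => (hW i).ne') d)

/-- The ideal generated by the first `i` polynomials of a system. -/
noncomputable def initialIdeal (F : Fin m → MvPolynomial (Fin N) K) (i : ℕ) : Ideal (MvPolynomial (Fin N) K) :=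
  Ideal.span (F '' {j | (j : ℕ) < i})

lemma initialIdeal_zero (F : Fin m → MvPolynomial (Fin N) K) : initialIdeal F 0 = ⊥ := by
  simp [initialIdeal]

lemma initialIdeal_succ (F : Fin m → MvPolynomial (Fin N) K) (i : Fin m) :
    initialIdeal F (i + 1) = initialIdeal F i ⊔ Ideal.span {F i} := by
  rw [initialIdeal, initialIdeal, ← Ideal.span_union]
  congr 1
  have : {j : Fin m | (j : ℕ) < i + 1} = {j : Fin m | (j : ℕ) < i} ∪ {i} := by
    ext j
    simp only [Set.mem_ofPred_eq, Set.union_singleton, Set.mem_insert_iff, Fin.ext_iff]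
    omega
  rw [this, Set.image_union, Set.image_singleton]

lemma initialIdeal_eq_span_range (F : Fin m → MvPolynomial (Fin N) K) :
    initialIdeal F m = Ideal.span (Set.range F) := by
  rw [initialIdeal, ← Set.image_univ]
  congr 2
  ext j
  simp

lemma initialIdeal_mono (F : Fin m → MvPolynomial (Fin N) K) {i j : ℕ} (h : i ≤ j) :
    initialIdeal F i ≤ initialIdeal F j :=
  Ideal.span_mono (Set.image_mono fun _ hl => lt_of_lt_of_le hl h)

lemma span_range_castLE (F : Fin m → MvPolynomial (Fin N) K) {i : ℕ} (hi : i ≤ m) :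
    Ideal.span (Set.range fun j : Fin i => F (Fin.castLE hi j)) = initialIdeal F i := by
  rw [initialIdeal]
  congr 1
  ext p
  constructor
  · rintro ⟨j, rfl⟩
    exact ⟨_, j.2, rfl⟩
  · rintro ⟨j, hj, rfl⟩
    exact ⟨⟨j, hj⟩, rfl⟩

/-- The ideal generated by the variables of index at least `k`. -/
noncomputable def variableIdeal (K : Type*) [Field K] (N k : ℕ) : Ideal (MvPolynomial (Fin N) K) :=
  Ideal.span (X '' {l : Fin N | k ≤ (l : ℕ)})

lemma variableIdeal_eq_sup (k : Fin N) :
    variableIdeal K N k = variableIdeal K N (k + 1) ⊔ Ideal.span {X k} := by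
  rw [variableIdeal, variableIdeal, ← Ideal.span_union]
  congr 1
  have : {l : Fin N | (k : ℕ) ≤ l} = {l : Fin N | (k : ℕ) + 1 ≤ l} ∪ {k} := by
    ext j
    simp only [Set.mem_ofPred_eq, Set.union_singleton, Set.mem_insert_iff, Fin.ext_iff]
    omega
  rw [this, Set.image_union, Set.image_singleton]

lemma mem_variableIdeal {k : ℕ} {p : MvPolynomial (Fin N) K} :
    p ∈ variableIdeal K N k ↔ ∀ a ∈ p.support, ∃ l : Fin N, k ≤ (l : ℕ) ∧ a l ≠ 0 := by
  rw [variableIdeal, mem_ideal_span_X_image]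
  rfl

lemma isHomogeneous_initialIdeal {W : Fin N → ℕ} {D : Fin m → ℕ} {F : Fin m → MvPolynomial (Fin N) K}
    (hF : ∀ i, IsWeightedHomogeneous W (F i) (D i)) (i : ℕ) :
    (initialIdeal F i).IsHomogeneous (weightedHomogeneousSubmodule K W) :=
  Ideal.homogeneous_span _ _ (by rintro _ ⟨j, -, rfl⟩; exact ⟨D j, hF j⟩)

lemma isHomogeneous_variableIdeal (W : Fin N → ℕ) (k : ℕ) :
    (variableIdeal K N k).IsHomogeneous (weightedHomogeneousSubmodule K W) :=
  Ideal.homogeneous_span _ _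
    (by rintro _ ⟨j, -, rfl⟩; exact ⟨W j, isWeightedHomogeneous_X K W j⟩)

lemma regularModulo_X_variableIdeal (k : Fin N) :
    RegularModulo (X k : MvPolynomial (Fin N) K) (variableIdeal K N (k + 1)) := by
  intro p hp
  rw [mem_variableIdeal] at hp ⊢
  intro a ha
  obtain ⟨l, hl, hal⟩ := hp (Finsupp.single k 1 + a) (by
    rw [mem_support_iff, coeff_X_mul]
    exact mem_support_iff.1 ha)
  refine ⟨l, hl, ?_⟩
  have : k ≠ l := by rintro rfl; omega
  simpa [Finsupp.single_apply, this] using hal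

lemma mem_variableIdeal_zero_of_pos_degree {W : Fin N → ℕ} {d : ℕ} (hd : 0 < d)
    {p : MvPolynomial (Fin N) K} (hp : IsWeightedHomogeneous W p d) :
    p ∈ variableIdeal K N 0 := by
  rw [mem_variableIdeal]
  intro a ha
  by_contra! h
  have : a = 0 := Finsupp.ext fun l => h l (Nat.zero_le _)
  have h2 := hp (mem_support_iff.1 ha)
  rw [this, map_zero] at h2
  omega

lemma sub_C_constantCoeff_mem_variableIdeal {k : ℕ} {p : MvPolynomial (Fin N) K}
    (hp : p ∈ supported K {l : Fin N | k ≤ (l : ℕ)}) :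
    p - C (constantCoeff p) ∈ variableIdeal K N k := by
  classical
  rw [mem_variableIdeal]
  intro a ha
  rw [mem_support_iff, coeff_sub, coeff_C] at ha
  by_cases h0 : a = 0
  · rw [h0] at ha
    simp [constantCoeff_eq] at ha
  · obtain ⟨l, hl⟩ : ∃ l, a l ≠ 0 := by
      by_contra! h
      exact h0 (Finsupp.ext h)
    refine ⟨l, ?_, hl⟩
    rw [if_neg (Ne.symm h0), sub_zero] at ha
    exact mem_supported.1 hp ((mem_vars_iff_mem_support l).2 ⟨a, mem_support_iff.2 ha, Finsupp.mem_support_iff.2 hl⟩)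

/-- A variable that is integral over `K[X_l, l ≥ k]` modulo a homogeneous ideal `I` is nilpotent
modulo `I + (X_l, l ≥ k)`. -/
lemma exists_X_pow_mem_of_isIntegral {W : Fin N → ℕ} (hW : ∀ i, 0 < W i)
    {I : Ideal (MvPolynomial (Fin N) K)} (hI : I.IsHomogeneous (weightedHomogeneousSubmodule K W))
    {k : ℕ} {j : Fin N}
    (h : IsIntegral (supported K {l : Fin N | k ≤ (l : ℕ)}) (Ideal.Quotient.mk I (X j))) :
    ∃ r, (X j : MvPolynomial (Fin N) K) ^ r ∈ I ⊔ variableIdeal K N k := by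
  obtain ⟨p, hp, hpj⟩ := h
  set J := I ⊔ variableIdeal K N k with hJ
  -- Modulo the variables of index at least `k`, the coefficients of the integral equation reduce to
  -- their constant terms.
  let c : supported K {l : Fin N | k ≤ (l : ℕ)} →+* K :=
    constantCoeff.comp (supported K {l : Fin N | k ≤ (l : ℕ)}).val.toRingHom
  have hq : Polynomial.aeval (X j : MvPolynomial (Fin N) K) (p.map c) ∈ J := by
    rw [← Ideal.Quotient.eq_zero_iff_mem]
    have h1 := congrArg (Ideal.Quotient.factor (le_sup_left : I ≤ J)) hpj
    rw [map_zero, Polynomial.hom_eval₂] at h1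
    rw [Polynomial.aeval_def, Polynomial.hom_eval₂, Polynomial.eval₂_map]
    rw [← h1]
    congr 1
    ext a
    refine (Ideal.Quotient.eq.2 (Ideal.mem_sup_right
      (sub_C_constantCoeff_mem_variableIdeal a.2))).symm
  have hmonic : (p.map c).Monic := hp.map c
  set q := p.map c
  refine ⟨q.natDegree, ?_⟩
  have hJh : J.IsHomogeneous (weightedHomogeneousSubmodule K W) :=
    hI.sup (isHomogeneous_variableIdeal W k)
  -- Distinct powers of `X j` have distinct weights, so this component of the monic polynomial is
  -- its leading power alone.
  have h2 := weightedHomogeneousComponent_mem_of_mem K W hJh hq (q.natDegree * W j)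
  convert h2 using 1
  rw [Polynomial.aeval_eq_sum_range, map_sum, Finset.sum_eq_single q.natDegree]
  · rw [hmonic.coeff_natDegree, one_smul, IsWeightedHomogeneous.weightedHomogeneousComponent_same]
    exact (isWeightedHomogeneous_X K W j).pow _
  · intro i _ hi
    have hXi : IsWeightedHomogeneous W ((X j : MvPolynomial (Fin N) K) ^ i) (i * W j) :=
      (isWeightedHomogeneous_X K W j).pow i
    rw [map_smul, hXi.weightedHomogeneousComponent_ne _
      (fun h => hi (Nat.eq_of_mul_eq_mul_right (hW j) h.symm)), smul_zero]
  · intro hn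
    exact absurd (Finset.mem_range.2 (Nat.lt_succ_self _)) hn

/-- Pigeonhole: a monomial of large weight has some exponent `a j ≥ r j`. -/
lemma mem_of_degree_large {W : Fin N → ℕ}
    {J : Ideal (MvPolynomial (Fin N) K)}
    (h : ∀ j : Fin N, ∃ r, (X j : MvPolynomial (Fin N) K) ^ r ∈ J) :
    ∃ B : ℕ, ∀ d : ℕ, B ≤ d → ∀ p ∈ weightedHomogeneousSubmodule K W d, p ∈ J := by
  choose r hr using h
  refine ⟨∑ j, r j * W j + 1, fun d hd p hp => ?_⟩
  rw [p.as_sum]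
  refine J.sum_mem fun a ha => ?_
  obtain ⟨j, hj⟩ : ∃ j, r j ≤ a j := by
    by_contra! hlt
    have h1 : Finsupp.weight W a = d := hp (mem_support_iff.1 ha)
    rw [Finsupp.weight_apply, Finsupp.sum_fintype _ _ (by simp)] at h1
    have : ∑ j, a j • W j ≤ ∑ j, r j * W j :=
      Finset.sum_le_sum fun j _ => Nat.mul_le_mul_right _ (hlt j).le
    omega
  rw [monomial_eq, Finsupp.prod_fintype _ _ (by simp)]
  refine J.mul_mem_left _ ?_
  rw [← Finset.mul_prod_erase _ _ (Finset.mem_univ j), ← Nat.sub_add_cancel hj, pow_add, mul_assoc]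
  exact J.mul_mem_left _ (J.mul_mem_right _ (hr j))

lemma IsInSimultaneousNoetherPosition.exists_degree_large {W D : Fin N → ℕ} (hW : ∀ i, 0 < W i)
    {F : Fin N → MvPolynomial (Fin N) K} (hF : ∀ i, IsWeightedHomogeneous W (F i) (D i))
    (hSNP : IsInSimultaneousNoetherPosition F) (i : Fin N) :
    ∃ B : ℕ, ∀ d : ℕ, B ≤ d → ∀ p ∈ weightedHomogeneousSubmodule K W d,
      p ∈ initialIdeal F (i + 1) ⊔ variableIdeal K N (i + 1) := by
  refine mem_of_degree_large fun j => ?_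
  rcases lt_or_ge (j : ℕ) (i + 1) with hj | hj
  · rw [← span_range_castLE F i.2]
    refine exists_X_pow_mem_of_isIntegral hW ?_ ((hSNP (i + 1) i.2 (Nat.succ_pos _)).1 j hj)
    rw [span_range_castLE F i.2]
    exact isHomogeneous_initialIdeal hF _
  · exact ⟨1, by
      rw [pow_one]
      exact Ideal.mem_sup_right (Ideal.subset_span ⟨j, hj, rfl⟩)⟩

end NoetherPosition

/-! ### Regularity and top degrees of the slices -/

section TopDegree

open MvPolynomial

attribute [local instance] MvPolynomial.weightedGradedAlgebra

variable {K : Type*} [Field K] {N : ℕ}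

/-- The ideal generated by the first `i` polynomials of a system and the variables of index at
least `k`. -/
noncomputable def sliceIdeal (F : Fin N → MvPolynomial (Fin N) K) (i k : ℕ) :
    Ideal (MvPolynomial (Fin N) K) :=
  initialIdeal F i ⊔ variableIdeal K N k

lemma sliceIdeal_succ (F : Fin N → MvPolynomial (Fin N) K) (i : Fin N) (k : ℕ) :
    sliceIdeal F (i + 1) k = sliceIdeal F i k ⊔ Ideal.span {F i} := by
  rw [sliceIdeal, sliceIdeal, initialIdeal_succ, sup_right_comm]

lemma sliceIdeal_eq_sup_X (F : Fin N → MvPolynomial (Fin N) K) (i : ℕ) (k : Fin N) :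
    sliceIdeal F i k = sliceIdeal F i (k + 1) ⊔ Ideal.span {X k} := by
  rw [sliceIdeal, sliceIdeal, variableIdeal_eq_sup, sup_assoc]

lemma isHomogeneous_sliceIdeal {W D : Fin N → ℕ} {F : Fin N → MvPolynomial (Fin N) K}
    (hF : ∀ i, IsWeightedHomogeneous W (F i) (D i)) (i k : ℕ) :
    (sliceIdeal F i k).IsHomogeneous (weightedHomogeneousSubmodule K W) :=
  (isHomogeneous_initialIdeal hF i).sup (isHomogeneous_variableIdeal W k)

/-- The partial sums `∑_{j < i} (d_j - w_j)`. -/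
def degreeExcess (W D : Fin N → ℕ) (i : ℕ) : ℤ :=
  ∑ j ∈ Finset.univ.filter (fun j : Fin N => (j : ℕ) < i), ((D j : ℤ) - W j)

lemma degreeExcess_zero (W D : Fin N → ℕ) : degreeExcess W D 0 = 0 := by
  simp [degreeExcess]

lemma degreeExcess_succ (W D : Fin N → ℕ) (i : Fin N) :
    degreeExcess W D (i + 1) = degreeExcess W D i + ((D i : ℤ) - W i) := by
  have : (Finset.univ.filter fun j : Fin N => (j : ℕ) < i + 1) =
      insert i (Finset.univ.filter fun j : Fin N => (j : ℕ) < i) := by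
    ext j
    simp only [Finset.mem_filter, Finset.mem_univ, true_and, Finset.mem_insert, Fin.ext_iff]
    omega
  rw [degreeExcess, degreeExcess, this, Finset.sum_insert (by simp), add_comm]

lemma degreeExcess_eq_sum (W D : Fin N → ℕ) :
    degreeExcess W D N = ∑ j, ((D j : ℤ) - W j) := by
  rw [degreeExcess, Finset.filter_true_of_mem fun j _ => j.2]

variable {W D : Fin N → ℕ} {F : Fin N → MvPolynomial (Fin N) K}

/-- The inductive step on Hilbert functions. Strong compatibility enters here: `F i` has the degree
of a power of `X i`. Noether position supplies only some large vanishing degree, which is then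
sharpened. -/
lemma regularModulo_sliceIdeal_self (hW : ∀ i, 0 < W i) (hD : IsStronglyCompatible W D)
    (hF : ∀ i, IsWeightedHomogeneous W (F i) (D i)) (hSNP : IsInSimultaneousNoetherPosition F)
    (i : Fin N) (hX : RegularModulo (X i) (sliceIdeal F i (i + 1)))
    {δ : ℤ} (hδ : ∀ d : ℕ, δ < d → ∀ p, IsWeightedHomogeneous W p d → p ∈ sliceIdeal F i i) :
    RegularModulo (F i) (sliceIdeal F i (i + 1)) ∧
      ∀ d : ℕ, δ + ((D i : ℤ) - W i) < d → ∀ p, IsWeightedHomogeneous W p d →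
        p ∈ sliceIdeal F (i + 1) (i + 1) := by
  have := finiteDimensional_weightedHomogeneousSubmodule (K := K) hW
  obtain ⟨c, hc⟩ := hD i
  rw [mul_comm] at hc
  have hFi : F i ∈ weightedHomogeneousSubmodule K W (c * W i) := hc ▸ hF i
  obtain ⟨B, hB⟩ := hSNP.exists_degree_large hW hF i
  change ∀ d : ℕ, B ≤ d → ∀ p ∈ _, p ∈ sliceIdeal F (i + 1) (i + 1) at hB
  rw [sliceIdeal_succ] at hB ⊢
  rw [sliceIdeal_eq_sup_X] at hδ
  have hJ := isHomogeneous_sliceIdeal hF i (i + 1)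
  have hreg := regularModulo_of_large_degrees (weightedHomogeneousSubmodule K W) hJ (hW i)
    (isWeightedHomogeneous_X K W i) hFi hX hδ hB
  refine ⟨hreg, ?_⟩
  rw [hc]
  exact mem_sup_span_singleton_of_degree_lt (weightedHomogeneousSubmodule K W) hJ (hW i)
    (isWeightedHomogeneous_X K W i) hFi hX hreg hδ

/-- The variables are removed from the ideal one at a time, each being regular modulo the smaller
ideal. -/
lemma regularModulo_sliceIdeal (hW : ∀ i, 0 < W i)
    (hF : ∀ i, IsWeightedHomogeneous W (F i) (D i)) (i : Fin N)
    (hX : ∀ k : Fin N, i ≤ k → RegularModulo (X k) (sliceIdeal F i (k + 1)))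
    (hself : RegularModulo (F i) (sliceIdeal F i (i + 1))) (k : ℕ) (hik : (i : ℕ) + 1 ≤ k)
    (hk : k ≤ N) : RegularModulo (F i) (sliceIdeal F i k) := by
  induction k, hik using Nat.le_induction with
  | base => exact hself
  | succ k hik ih =>
    have h1 := ih (by omega)
    have h2 := sliceIdeal_eq_sup_X F i ⟨k, hk⟩
    rw [Fin.val_mk] at h2
    rw [h2] at h1
    exact RegularModulo.of_sup_span_singleton (weightedHomogeneousSubmodule K W)
      (isHomogeneous_sliceIdeal hF i (k + 1)) (hW ⟨k, hk⟩) (isWeightedHomogeneous_X K W ⟨k, hk⟩)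
      (hF i) (hX ⟨k, hk⟩ (by rw [Fin.le_def]; simp only; omega)) h1

/-- Both halves go through one induction. Adding `F i` keeps `X k` regular because the regular
sequence `X k`, `F i` can be exchanged; this needs `F i` regular modulo the slices with more free
variables, hence the first half for all `k ≥ i`. -/
theorem regularModulo_X_and_mem_sliceIdeal (hW : ∀ i, 0 < W i) (hD : IsStronglyCompatible W D)
    (hF : ∀ i, IsWeightedHomogeneous W (F i) (D i)) (hSNP : IsInSimultaneousNoetherPosition F)
    (i : ℕ) (hi : i ≤ N) :
    (∀ k : Fin N, i ≤ k → RegularModulo (X k) (sliceIdeal F i (k + 1))) ∧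
      ∀ d : ℕ, degreeExcess W D i < d → ∀ p, IsWeightedHomogeneous W p d →
        p ∈ sliceIdeal F i i := by
  induction i with
  | zero =>
    simp only [sliceIdeal, initialIdeal_zero, bot_sup_eq, degreeExcess_zero]
    exact ⟨fun k _ => regularModulo_X_variableIdeal k, fun d hd p hp =>
      mem_variableIdeal_zero_of_pos_degree (by exact_mod_cast hd) hp⟩
  | succ i ih =>
    obtain ⟨hX, hδ⟩ := ih (by omega)
    obtain ⟨hself, htop⟩ := regularModulo_sliceIdeal_self hW hD hF hSNP ⟨i, hi⟩
      (hX ⟨i, hi⟩ le_rfl) hδ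
    refine ⟨fun k hk => ?_, ?_⟩
    · have h1 := regularModulo_sliceIdeal hW hF ⟨i, hi⟩ (fun k hk => hX k hk) hself k hk k.2.le
      rw [sliceIdeal_eq_sup_X] at h1
      have h2 := (hX k (by omega)).sup_span_singleton h1
      rwa [← sliceIdeal_succ F ⟨i, hi⟩] at h2
    · rwa [← degreeExcess_succ W D ⟨i, hi⟩] at htop

lemma regularModulo_of_isInSimultaneousNoetherPosition (hW : ∀ i, 0 < W i)
    (hD : IsStronglyCompatible W D)
    (hF : ∀ i, IsWeightedHomogeneous W (F i) (D i)) (hSNP : IsInSimultaneousNoetherPosition F)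
    (i : Fin N) : RegularModulo (F i) (sliceIdeal F i (i + 1)) := by
  obtain ⟨hX, hδ⟩ := regularModulo_X_and_mem_sliceIdeal hW hD hF hSNP i i.2.le
  exact (regularModulo_sliceIdeal_self hW hD hF hSNP i (hX i le_rfl) hδ).1

/-- The `W`-degrees of a system in simultaneous Noether position are positive. -/
lemma pos_of_isInSimultaneousNoetherPosition (hW : ∀ i, 0 < W i) (hD : IsStronglyCompatible W D)
    (hF : ∀ i, IsWeightedHomogeneous W (F i) (D i)) (hSNP : IsInSimultaneousNoetherPosition F)
    (i : Fin N) : 0 < D i := by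
  have hC : ∀ j, C (constantCoeff (F j)) ∈ initialIdeal F N := by
    intro j
    have h := weightedHomogeneousComponent_mem_of_mem K W (isHomogeneous_initialIdeal hF N)
      (Ideal.subset_span ⟨j, j.2, rfl⟩ : F j ∈ initialIdeal F N) 0
    rwa [weightedHomogeneousComponent_zero _ (fun x => (hW x).ne')] at h
  -- For the full system no variable is free, so the intersection clause of Noether position says
  -- that the ideal contains no nonzero constant.
  have hc : ∀ j, constantCoeff (F j) = 0 := by
    intro j
    have h := (hSNP N le_rfl (by have := j.2; omega)).2 (C (constantCoeff (F j)))
      (Subalgebra.algebraMap_mem _ _)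
    rw [span_range_castLE] at h
    exact C_eq_zero.1 (h (hC j))
  have hle : sliceIdeal F i (i + 1) ≤ RingHom.ker (constantCoeff (R := K) (σ := Fin N)) := by
    refine sup_le (Ideal.span_le.2 ?_) (Ideal.span_le.2 ?_)
    · rintro _ ⟨j, -, rfl⟩
      exact hc j
    · rintro _ ⟨j, -, rfl⟩
      simp
  -- In degree 0, `F i` would be a constant, hence zero; its regularity would then put 1 in the
  -- slice.
  by_contra h0
  have hFi : F i = 0 := by
    have h := (hF i).weightedHomogeneousComponent_same
    rw [Nat.eq_zero_of_not_pos h0, weightedHomogeneousComponent_zero _ (fun x => (hW x).ne')] at h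
    rw [← h]
    have := hc i
    rw [constantCoeff_eq] at this
    rw [this, C_0]
  have h1 := regularModulo_of_isInSimultaneousNoetherPosition hW hD hF hSNP i 1
    (by rw [hFi, zero_mul]; exact zero_mem _)
  have h2 : constantCoeff (1 : MvPolynomial (Fin N) K) = 0 := hle h1
  simp at h2

lemma weight_le_degree_of_isInSimultaneousNoetherPosition (hW : ∀ i, 0 < W i)
    (hD : IsStronglyCompatible W D)
    (hF : ∀ i, IsWeightedHomogeneous W (F i) (D i)) (hSNP : IsInSimultaneousNoetherPosition F)
    (i : Fin N) : W i ≤ D i :=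
  Nat.le_of_dvd (pos_of_isInSimultaneousNoetherPosition hW hD hF hSNP i) (hD i)

end TopDegree

/-! ### Row spaces of the Matrix-F5 matrices -/

section MatrixF5

open MvPolynomial

attribute [local instance] MvPolynomial.weightedGradedAlgebra

variable {K : Type*} [Field K] {m n : ℕ}

lemma degree_eq_of_mem_support {p : MvPolynomial (Fin n) K} {d : ℕ} (hp : p.IsHomogeneous d)
    {v : Fin n →₀ ℕ} (hv : v ∈ p.support) : v.degree = d := by
  rw [Finsupp.degree_eq_weight_one]
  exact hp (mem_support_iff.1 hv)

lemma mem_leadingMonomials_of_forall_le {mo : MonomialOrder (Fin n)}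
    {G : Set (MvPolynomial (Fin n) K)} {p : MvPolynomial (Fin n) K} (hp : p ∈ G)
    {a : Fin n →₀ ℕ} (ha : a ∈ p.support) (h : ∀ b ∈ p.support, mo.toSyn b ≤ mo.toSyn a) :
    a ∈ leadingMonomials mo G := by
  have h0 : p ≠ 0 := by
    rintro rfl
    simp at ha
  exact ⟨p, hp, h0, mo.toSyn.injective (le_antisymm (mo.degree_le_iff.2 h) (mo.le_degree ha))⟩

/-- The rows rejected by the F5 criterion are redundant. -/
lemma monomial_mul_mem_span_matrixF5Rows {mo : MonomialOrder (Fin n)}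
    {f : Fin m → MvPolynomial (Fin n) K} {e : Fin m → ℕ}
    (hf : ∀ i, (f i).IsHomogeneous (e i)) (i : Fin m)
    (ih : ∀ d p, p ∈ Submodule.span K (matrixF5Rows mo f i d) ↔
      p.IsHomogeneous d ∧ p ∈ initialIdeal f i) (u : Fin n →₀ ℕ) :
    monomial u 1 * f i ∈ Submodule.span K (matrixF5Rows mo f (i + 1) (u.degree + e i)) := by
  by_cases hfi : f i = 0
  · rw [hfi, mul_zero]
    exact zero_mem _
  obtain ⟨s, hs⟩ : ∃ s, mo.toSyn u = s := ⟨_, rfl⟩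
  induction s using WellFoundedLT.induction generalizing u with
  | _ s IH =>
    -- If `u` is rejected, it leads some `h` in the previous row space. Then `h * f i` is already in
    -- the old rows, and the tail of `h` involves smaller monomials of the same degree, handled by
    -- induction.
    by_cases hu : u ∈ leadingMonomials mo (Submodule.span K (matrixF5Rows mo f i u.degree) :
        Set (MvPolynomial (Fin n) K))
    · obtain ⟨h, hh, h0, rfl⟩ := hu
      obtain ⟨hhom, hmem⟩ := (ih _ _).1 hh
      have hlc : h.coeff (mo.degree h) ≠ 0 := mo.coeff_degree_ne_zero_iff.2 h0
      have hsplit : h = monomial (mo.degree h) (h.coeff (mo.degree h)) +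
          ∑ v ∈ h.support.erase (mo.degree h), monomial v (h.coeff v) := by
        rw [Finset.add_sum_erase _ (fun v => monomial v (h.coeff v)) (mo.degree_mem_support h0)]
        exact h.as_sum
      have hmon : ∀ v, monomial v (h.coeff v) * f i = h.coeff v • (monomial v 1 * f i) := by
        intro v
        rw [← smul_mul_assoc, smul_monomial, smul_eq_mul, mul_one]
      have htail : (∑ v ∈ h.support.erase (mo.degree h), monomial v (h.coeff v)) * f i ∈
          Submodule.span K (matrixF5Rows mo f (i + 1) ((mo.degree h).degree + e i)) := by
        rw [Finset.sum_mul]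
        refine Submodule.sum_mem _ fun v hv => ?_
        obtain ⟨hne, hv⟩ := Finset.mem_erase.1 hv
        have hdeg : v.degree = (mo.degree h).degree := degree_eq_of_mem_support hhom hv
        rw [hmon]
        refine Submodule.smul_mem _ _ ?_
        rw [← hdeg]
        exact IH _ (hs ▸ lt_of_le_of_ne (mo.le_degree hv) fun e => hne (mo.toSyn.injective e)) v rfl
      have hall : h * f i ∈
          Submodule.span K (matrixF5Rows mo f (i + 1) ((mo.degree h).degree + e i)) := by
        refine Submodule.span_mono (s := matrixF5Rows mo f i _) Set.subset_union_left ?_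
        exact (ih _ _).2 ⟨hhom.mul (hf i), Ideal.mul_mem_right _ _ hmem⟩
      have hlead : h.coeff (mo.degree h) • (monomial (mo.degree h) 1 * f i) ∈
          Submodule.span K (matrixF5Rows mo f (i + 1) ((mo.degree h).degree + e i)) := by
        have := Submodule.sub_mem _ hall htail
        rwa [← sub_mul, ← eq_sub_of_add_eq hsplit.symm, hmon] at this
      exact (Submodule.smul_mem_iff _ hlc).1 hlead
    · refine Submodule.subset_span (Or.inr ⟨i.2, u, ?_, hu, rfl⟩)
      rw [(hf i).totalDegree hfi]

/-- The row spaces of the matrices of the Matrix-F5 algorithm on homogeneous polynomials are the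
homogeneous parts of the ideals generated by the first polynomials. -/
lemma mem_span_matrixF5Rows {mo : MonomialOrder (Fin n)}
    {f : Fin m → MvPolynomial (Fin n) K} {e : Fin m → ℕ}
    (hf : ∀ i, (f i).IsHomogeneous (e i)) (i : ℕ) (hi : i ≤ m) (d : ℕ)
    (p : MvPolynomial (Fin n) K) :
    p ∈ Submodule.span K (matrixF5Rows mo f i d) ↔
      p.IsHomogeneous d ∧ p ∈ initialIdeal f i := by
  induction i generalizing d p with
  | zero =>
    rw [initialIdeal_zero, matrixF5Rows, Submodule.span_empty]
    simp only [Submodule.mem_bot]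
    constructor
    · rintro rfl
      exact ⟨isHomogeneous_zero _ _ _, rfl⟩
    · exact fun h => h.2
  | succ i ih =>
    have ih' := ih (by omega)
    have hsucc := initialIdeal_succ f ⟨i, hi⟩
    rw [Fin.val_mk] at hsucc
    constructor
    · intro hp
      suffices hle : Submodule.span K (matrixF5Rows mo f (i + 1) d) ≤
          homogeneousSubmodule (Fin n) K d ⊓
            (initialIdeal f (i + 1)).restrictScalars K from hle hp
      rw [Submodule.span_le]
      rintro q (hq | ⟨_, u, hu, -, rfl⟩)
      · obtain ⟨h1, h2⟩ := (ih' d q).1 (Submodule.subset_span hq)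
        exact ⟨h1, initialIdeal_mono f (Nat.le_succ i) h2⟩
      · refine ⟨?_, Ideal.mul_mem_left _ _ (Ideal.subset_span ⟨⟨i, hi⟩, Nat.lt_succ_self i, rfl⟩)⟩
        by_cases h0 : f ⟨i, hi⟩ = 0
        · rw [h0, mul_zero]
          exact zero_mem _
        · rw [(hf _).totalDegree h0] at hu
          rw [← hu]
          exact (isHomogeneous_monomial _ rfl).mul (hf _)
    · rintro ⟨hp, hpI⟩
      rw [hsucc] at hpI
      have hmono : Submodule.span K (matrixF5Rows mo f i d) ≤
          Submodule.span K (matrixF5Rows mo f (i + 1) d) :=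
        Submodule.span_mono Set.subset_union_left
      rcases exists_homogeneous_cofactor (weightedHomogeneousSubmodule K (1 : Fin n → ℕ))
        (isHomogeneous_initialIdeal hf i) (hf ⟨i, hi⟩) hp hpI with h | ⟨d', q, rfl, hq, hpq⟩
      · exact hmono ((ih' d p).2 ⟨hp, h⟩)
      · have h1 : p - f ⟨i, hi⟩ * q ∈ Submodule.span K (matrixF5Rows mo f (i + 1) (d' + e ⟨i, hi⟩)) := by
          refine hmono ((ih' _ _).2 ⟨hp.sub ?_, hpq⟩)
          rw [mul_comm]
          exact IsHomogeneous.mul hq (hf _)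
        have h2 : f ⟨i, hi⟩ * q ∈
            Submodule.span K (matrixF5Rows mo f (i + 1) (d' + e ⟨i, hi⟩)) := by
          rw [mul_comm, q.as_sum, Finset.sum_mul]
          refine Submodule.sum_mem _ fun u hu => ?_
          have hdeg : u.degree = d' := degree_eq_of_mem_support hq hu
          have h3 := monomial_mul_mem_span_matrixF5Rows hf ⟨i, hi⟩ ih' u
          rw [hdeg] at h3
          have h4 := Submodule.smul_mem _ (q.coeff u) h3
          rwa [← smul_mul_assoc, smul_monomial, smul_eq_mul, mul_one] at h4
        simpa using Submodule.add_mem _ h1 h2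

/-- A run of Matrix-F5 on homogeneous polynomials up to a degree `B` is complete if `B` bounds the
degrees of the polynomials and the leading monomials of the ideal are divisible by leading
monomials of degree at most `B`. -/
lemma matrixF5Complete_of_leadingMonomials {mo : MonomialOrder (Fin n)}
    {f : Fin m → MvPolynomial (Fin n) K} {e : Fin m → ℕ}
    (hf : ∀ i, (f i).IsHomogeneous (e i)) {B : ℕ} (he : ∀ i, e i ≤ B)
    (hB : ∀ a ∈ leadingMonomials mo (Ideal.span (Set.range f) : Set (MvPolynomial (Fin n) K)),
      ∃ b ∈ leadingMonomials mo (Ideal.span (Set.range f) : Set (MvPolynomial (Fin n) K)),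
        b ≤ a ∧ b.degree ≤ B) : MatrixF5Complete mo f B := by
  classical
  refine ⟨fun i => (hf i).totalDegree_le.trans (he i), ?_, fun a ha => ?_⟩
  · rintro p ⟨d, -, hp⟩
    rw [← initialIdeal_eq_span_range]
    exact ((mem_span_matrixF5Rows hf m le_rfl d p).1 hp).2
  · obtain ⟨b, ⟨h, hh, h0, rfl⟩, hba, hbB⟩ := hB a ha
    -- The order `mo` need not be graded, so `h` is cut down to the component containing its leading
    -- term.
    refine ⟨_, mem_leadingMonomials_of_forall_le
      (p := homogeneousComponent (mo.degree h).degree h) ?_ ?_ fun b hb => ?_, hba⟩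
    · refine ⟨_, hbB, (mem_span_matrixF5Rows hf m le_rfl _ _).2
        ⟨homogeneousComponent_isHomogeneous _ _, ?_⟩⟩
      have hI := isHomogeneous_initialIdeal hf m
      rw [initialIdeal_eq_span_range] at hI ⊢
      exact weightedHomogeneousComponent_mem_of_mem K 1 hI hh _
    · rw [mem_support_iff, coeff_homogeneousComponent, if_pos rfl]
      exact mo.coeff_degree_ne_zero_iff.2 h0
    · refine mo.le_degree (mem_support_iff.2 fun hb0 => mem_support_iff.1 hb ?_)
      rw [coeff_homogeneousComponent, hb0, ite_self]

end MatrixF5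

/-! ### Leading monomials after the weighted substitution -/

section WeightedSubstitution

open MvPolynomial

attribute [local instance] MvPolynomial.weightedGradedAlgebra

variable {K : Type*} [Field K] {m n : ℕ} {W : Fin n → ℕ}

/-- The exponent vector of the image of a monomial under `X_i ↦ t_i ^ w_i`. -/
noncomputable def scaleExponent (W : Fin n → ℕ) (a : Fin n →₀ ℕ) : Fin n →₀ ℕ :=
  Finsupp.equivFunOnFinite.symm fun i => W i * a i

@[simp]
lemma scaleExponent_apply (a : Fin n →₀ ℕ) (i : Fin n) : scaleExponent W a i = W i * a i := rfl

lemma degree_scaleExponent (a : Fin n →₀ ℕ) :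
    (scaleExponent W a).degree = Finsupp.weight W a := by
  rw [Finsupp.degree_eq_sum, Finsupp.weight_apply, Finsupp.sum_fintype _ _ (by simp)]
  exact Finset.sum_congr rfl fun i _ => mul_comm _ _

lemma homW_monomial (a : Fin n →₀ ℕ) (c : K) :
    homW W (monomial a c) = monomial (scaleExponent W a) c := by
  rw [homW, aeval_monomial, monomial_eq, algebraMap_eq, Finsupp.prod_fintype _ _ (by simp),
    Finsupp.prod_fintype _ _ (by simp)]
  congr 1
  exact Finset.prod_congr rfl fun i _ => by rw [scaleExponent_apply, pow_mul]

lemma isHomogeneous_homW {p : MvPolynomial (Fin n) K} {d : ℕ} (hp : IsWeightedHomogeneous W p d) :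
    (homW W p).IsHomogeneous d := by
  rw [p.as_sum, map_sum]
  refine IsHomogeneous.sum _ _ _ fun a ha => ?_
  rw [homW_monomial]
  refine isHomogeneous_monomial _ ?_
  rw [degree_scaleExponent]
  exact hp (mem_support_iff.1 ha)

/-- The terms whose exponents have the residues `r` modulo the weights, divided by `t ^ r`. -/
noncomputable def residuePart (W : Fin n → ℕ) (r : Fin n →₀ ℕ) :
    MvPolynomial (Fin n) K →ₗ[K] MvPolynomial (Fin n) K :=
  open Classical in
  (basisMonomials (Fin n) K).constr K fun a =>
    if ∀ i, a i % W i = r i then monomial (a - r) 1 else 0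

open Classical in
lemma residuePart_monomial (r a : Fin n →₀ ℕ) (c : K) :
    residuePart W r (monomial a c) =
      if ∀ i, a i % W i = r i then monomial (a - r) c else 0 := by
  have h := (basisMonomials (Fin n) K).constr_basis K (fun a : Fin n →₀ ℕ =>
    if ∀ i, a i % W i = r i then (monomial (a - r) 1 : MvPolynomial (Fin n) K) else 0) a
  rw [coe_basisMonomials] at h
  have hc : (monomial a c : MvPolynomial (Fin n) K) = c • monomial a 1 := by
    rw [smul_monomial, smul_eq_mul, mul_one]
  rw [hc, map_smul, residuePart, h]
  split_ifs
  · rw [smul_monomial, smul_eq_mul, mul_one]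
  · rw [smul_zero]

open Classical in
lemma coeff_residuePart (r b : Fin n →₀ ℕ) (p : MvPolynomial (Fin n) K) :
    coeff b (residuePart W r p) =
      if ∀ i, (b + r) i % W i = r i then coeff (b + r) p else 0 := by
  induction p using MvPolynomial.induction_on' with
  | add p q hp hq =>
    rw [map_add, coeff_add, hp, hq, coeff_add]
    split_ifs <;> simp
  | monomial a c =>
    rw [residuePart_monomial, coeff_monomial]
    by_cases hab : a = b + r
    · subst hab
      rw [if_pos rfl, add_tsub_cancel_right]
      split_ifs
      · rw [coeff_monomial, if_pos rfl]
      · rw [coeff_zero]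
    · rw [if_neg hab, ite_self]
      split_ifs with h
      · rw [coeff_monomial, if_neg]
        rintro rfl
        refine hab (tsub_add_cancel_of_le fun i => ?_).symm
        rw [← h i]
        exact Nat.mod_le _ _
      · rw [coeff_zero]

/-- Monomials in the `t_i ^ w_i` shift exponents by multiples of the weights and leave residues
unchanged. This linearity makes `residuePart` preserve the substituted ideal. -/
lemma residuePart_homW_mul (r : Fin n →₀ ℕ) (q p : MvPolynomial (Fin n) K) :
    residuePart W r (homW W q * p) = homW W q * residuePart W r p := by
  classical
  induction q using MvPolynomial.induction_on' with
  | add q₁ q₂ h₁ h₂ => rw [map_add, add_mul, add_mul, map_add, h₁, h₂]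
  | monomial b x =>
    induction p using MvPolynomial.induction_on' with
    | add p₁ p₂ h₁ h₂ => rw [map_add, mul_add, mul_add, map_add, h₁, h₂]
    | monomial a y =>
      rw [homW_monomial, monomial_mul, residuePart_monomial, residuePart_monomial]
      have hiff : (∀ i, (scaleExponent W b + a) i % W i = r i) ↔ ∀ i, a i % W i = r i := by
        simp only [Finsupp.add_apply, scaleExponent_apply, Nat.mul_add_mod]
      by_cases h : ∀ i, a i % W i = r i
      · rw [if_pos h, if_pos (hiff.2 h), monomial_mul, add_tsub_assoc_of_le]
        intro i
        rw [← h i]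
        exact Nat.mod_le _ _
      · rw [if_neg h, if_neg (fun h' => h (hiff.1 h')), mul_zero]

lemma residuePart_mem {F : Fin m → MvPolynomial (Fin n) K} (r : Fin n →₀ ℕ)
    {p : MvPolynomial (Fin n) K}
    (hp : p ∈ Ideal.span (Set.range fun i => homW W (F i))) :
    residuePart W r p ∈ Ideal.span (Set.range fun i => homW W (F i)) := by
  obtain ⟨c, rfl⟩ := (Submodule.mem_span_range_iff_exists_fun _).1 hp
  rw [map_sum]
  refine Ideal.sum_mem _ fun i _ => ?_
  rw [smul_eq_mul, mul_comm, residuePart_homW_mul]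
  exact Ideal.mul_mem_right _ _ (Ideal.subset_span ⟨i, rfl⟩)

/-- Rounding the exponents down to multiples of the weights maps leading monomials of an ideal
generated by polynomials in the `t_i ^ w_i` to leading monomials of this ideal. -/
lemma scaleExponent_div_mem_leadingMonomials (mo : MonomialOrder (Fin n))
    {F : Fin m → MvPolynomial (Fin n) K} {a c : Fin n →₀ ℕ} (hc : ∀ i, c i = a i / W i)
    (ha : a ∈ leadingMonomials mo
      (Ideal.span (Set.range fun i => homW W (F i)) : Set (MvPolynomial (Fin n) K))) :
    scaleExponent W c ∈ leadingMonomials mo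
      (Ideal.span (Set.range fun i => homW W (F i)) : Set (MvPolynomial (Fin n) K)) := by
  classical
  obtain ⟨h, hh, h0, rfl⟩ := ha
  set a := mo.degree h with hadef
  set r : Fin n →₀ ℕ := Finsupp.equivFunOnFinite.symm fun i => a i % W i with hr
  have hri : ∀ i, r i = a i % W i := fun _ => rfl
  have hsum : scaleExponent W c + r = a := by
    ext i
    rw [Finsupp.add_apply, scaleExponent_apply, hc, hri, Nat.div_add_mod]
  refine mem_leadingMonomials_of_forall_le (residuePart_mem r hh) ?_ fun b hb => ?_
  · rw [mem_support_iff, coeff_residuePart, hsum, if_pos fun i => (hri i).symm]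
    exact mo.coeff_degree_ne_zero_iff.2 h0
  · rw [mem_support_iff, coeff_residuePart] at hb
    have hb' : b + r ∈ h.support := mem_support_iff.2 fun h' => hb (by rw [h', ite_self])
    have hle := mo.le_degree hb'
    rw [← hadef, ← hsum, map_add, map_add] at hle
    exact le_of_add_le_add_right hle

lemma homW_mem_variableIdeal (hW : ∀ i, 0 < W i) {k : ℕ} {p : MvPolynomial (Fin n) K}
    (hp : p ∈ variableIdeal K n k) : homW W p ∈ variableIdeal K n k := by
  suffices h : variableIdeal K n k ≤ (variableIdeal K n k).comap (homW W) from h hp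
  refine Ideal.span_le.2 ?_
  rintro _ ⟨l, hl, rfl⟩
  change homW W (X l) ∈ variableIdeal K n k
  rw [homW, aeval_X]
  exact Ideal.pow_mem_of_mem _ (Ideal.subset_span (Set.mem_image_of_mem X hl)) _ (hW l)

lemma homW_mem_span {F : Fin m → MvPolynomial (Fin n) K} {k : ℕ} {p : MvPolynomial (Fin n) K}
    (hp : p ∈ initialIdeal F k) :
    homW W p ∈ Ideal.span (Set.range fun i => homW W (F i)) := by
  suffices h : initialIdeal F k ≤
      (Ideal.span (Set.range fun i => homW W (F i))).comap (homW W) from h hp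
  refine Ideal.span_le.2 ?_
  rintro _ ⟨l, -, rfl⟩
  exact Ideal.subset_span ⟨l, rfl⟩

/-- A monomial in the first `k` variables that is in the ideal generated by the `f_i` and the last
variables becomes a leading monomial for the graded reverse lexicographic order. -/
lemma scaleExponent_mem_leadingMonomials (hW : ∀ i, 0 < W i)
    {F : Fin n → MvPolynomial (Fin n) K} {D : Fin n → ℕ}
    (hF : ∀ i, IsWeightedHomogeneous W (F i) (D i)) {k : ℕ} {c : Fin n →₀ ℕ}
    (hck : ∀ l : Fin n, k ≤ (l : ℕ) → c l = 0)
    (hc : monomial c 1 ∈ sliceIdeal F k k) :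
    scaleExponent W c ∈ leadingMonomials (grevlex n)
      (Ideal.span (Set.range fun i => homW W (F i)) : Set (MvPolynomial (Fin n) K)) := by
  classical
  obtain ⟨h, hh, r, hr, hsum⟩ := Submodule.mem_sup.1 hc
  have hsum' : homW W h = monomial (scaleExponent W c) 1 - homW W r := by
    rw [eq_sub_iff_add_eq, ← map_add, hsum, homW_monomial]
  have hcoeff : coeff (scaleExponent W c) (homW W r) = 0 := by
    by_contra hne
    obtain ⟨l, hl, hcl⟩ := mem_variableIdeal.1 (homW_mem_variableIdeal hW hr) _
      (mem_support_iff.2 hne)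
    exact hcl (by rw [scaleExponent_apply, hck l hl, mul_zero])
  have hI := isHomogeneous_initialIdeal (fun i => isHomogeneous_homW (hF i)) n
  rw [initialIdeal_eq_span_range] at hI
  refine mem_leadingMonomials_of_forall_le
    (weightedHomogeneousComponent_mem_of_mem K 1 hI (homW_mem_span hh)
      (scaleExponent W c).degree) ?_ fun b hb => ?_
  · change _ ∈ (homogeneousComponent _ _).support
    rw [mem_support_iff, coeff_homogeneousComponent, if_pos rfl, hsum', coeff_sub, hcoeff,
      coeff_monomial, if_pos rfl, sub_zero]
    exact one_ne_zero
  · change _ ∈ (homogeneousComponent _ _).support at hb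
    rw [mem_support_iff, coeff_homogeneousComponent, ite_ne_right_iff, hsum', coeff_sub,
      coeff_monomial] at hb
    obtain ⟨hdeg, hb⟩ := hb
    by_cases hbc : scaleExponent W c = b
    · rw [hbc]
    rw [if_neg hbc, zero_sub, neg_ne_zero] at hb
    obtain ⟨l, hl, hbl⟩ := mem_variableIdeal.1 (homW_mem_variableIdeal hW hr) _
      (mem_support_iff.2 hb)
    -- The last variable of `b` has index at least `k` and is absent from `scaleExponent W c`; at
    -- equal degree this makes `b` smaller.
    refine (grevlex_lt_iff.2 (Or.inr ⟨hdeg, ?_⟩)).le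
    obtain ⟨i, hi, hmax⟩ := Finset.exists_max_image b.support id
      ⟨l, Finsupp.mem_support_iff.2 hbl⟩
    have hzero : ∀ j, i ≤ j → scaleExponent W c j = 0 := by
      intro j hij
      have hli : l ≤ i := hmax l (Finsupp.mem_support_iff.2 hbl)
      rw [scaleExponent_apply, hck j (hl.trans (hli.trans hij)), mul_zero]
    refine ⟨i, ?_, fun j hij => ?_⟩
    · rw [hzero i le_rfl]
      exact Nat.pos_of_ne_zero (Finsupp.mem_support_iff.1 hi)
    · rw [hzero j hij.le]
      by_contra hne
      exact absurd (hmax j (Finsupp.mem_support_iff.2 hne)) (not_le.2 hij)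

/-- Every leading monomial of the ideal is divisible by a leading monomial whose degree is at most
one of the numbers `∑_{i ≤ k} (d_i - w_i) + w_k`, or by `1`. -/
theorem exists_leadingMonomial_degree_le (hW : ∀ i, 0 < W i) {D : Fin n → ℕ}
    (hD : IsStronglyCompatible W D) {F : Fin n → MvPolynomial (Fin n) K}
    (hF : ∀ i, IsWeightedHomogeneous W (F i) (D i)) (hSNP : IsInSimultaneousNoetherPosition F)
    {B : ℕ} (hB : ∀ k : Fin n, degreeExcess W D (k + 1) + W k ≤ B) (a : Fin n →₀ ℕ)
    (ha : a ∈ leadingMonomials (grevlex n)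
      (Ideal.span (Set.range fun i => homW W (F i)) : Set (MvPolynomial (Fin n) K))) :
    ∃ b ∈ leadingMonomials (grevlex n)
      (Ideal.span (Set.range fun i => homW W (F i)) : Set (MvPolynomial (Fin n) K)),
      b ≤ a ∧ b.degree ≤ B := by
  induction ha' : a.degree using Nat.strong_induction_on generalizing a with
  | _ s ih =>
    subst ha'
    set S := leadingMonomials (grevlex n)
      (Ideal.span (Set.range fun i => homW W (F i)) : Set (MvPolynomial (Fin n) K)) with hS
    have hstep : ∀ b ∈ S, b ≤ a → b ≠ a → ∃ b ∈ S, b ≤ a ∧ b.degree ≤ B := by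
      intro b hb hba hne
      have hlt : b.degree < a.degree := by
        obtain ⟨c, rfl⟩ := exists_add_of_le hba
        have hc : c.degree ≠ 0 := fun h => hne (by
          rw [Finsupp.degree_eq_zero_iff] at h
          rw [h, add_zero])
        rw [map_add]
        omega
      obtain ⟨b', hb', hle, hdeg⟩ := ih _ hlt b hb rfl
      exact ⟨b', hb', hle.trans hba, hdeg⟩
    set c : Fin n →₀ ℕ := Finsupp.equivFunOnFinite.symm fun i => a i / W i with hc
    have hca : scaleExponent W c ∈ S :=
      scaleExponent_div_mem_leadingMonomials _ (fun _ => rfl) ha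
    by_cases hne : scaleExponent W c = a
    swap
    · exact hstep _ hca (fun i => Nat.mul_div_le _ _) hne
    rcases c.support.eq_empty_or_nonempty with h0 | hnonempty
    · refine ⟨a, ha, le_rfl, ?_⟩
      rw [← hne, Finsupp.support_eq_empty.1 h0, degree_scaleExponent, map_zero]
      exact Nat.zero_le _
    obtain ⟨k, hk, hmax⟩ := Finset.exists_max_image c.support id hnonempty
    have hk1 : Finsupp.single k 1 ≤ c :=
      Finsupp.single_le_iff.2 (Nat.one_le_iff_ne_zero.2 (Finsupp.mem_support_iff.1 hk))
    obtain ⟨c', hcc'⟩ := exists_add_of_le hk1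
    have hweight : Finsupp.weight W c = W k + Finsupp.weight W c' := by
      rw [hcc', map_add, Finsupp.weight_single, one_smul]
    by_cases hmem : scaleExponent W c' ∈ S
    · refine hstep _ hmem ?_ ?_
      · rw [← hne, hcc']
        intro i
        simp only [scaleExponent_apply, Finsupp.add_apply]
        exact Nat.mul_le_mul_left _ (Nat.le_add_left _ _)
      · rw [← hne]
        intro heq
        have := congrArg Finsupp.degree heq
        rw [degree_scaleExponent, degree_scaleExponent] at this
        have := hW k
        omega
    · refine ⟨a, ha, le_rfl, ?_⟩
      -- As `k` is the last index in `c`, `c'` involves only indices up to `k`; too large a weight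
      -- would make `scaleExponent W c'` a leading monomial.
      have hle : (Finsupp.weight W c' : ℤ) ≤ degreeExcess W D (k + 1) := by
        by_contra! hlt
        refine hmem (scaleExponent_mem_leadingMonomials hW hF (k := k + 1) (fun l hl => ?_)
          ((regularModulo_X_and_mem_sliceIdeal hW hD hF hSNP (k + 1) k.2).2 _ hlt _
            (isWeightedHomogeneous_monomial W c' 1 rfl)))
        by_contra hl0
        have hlc : l ∈ c.support := by
          rw [Finsupp.mem_support_iff, hcc', Finsupp.add_apply]
          omega
        have : l ≤ k := hmax l hlc
        rw [Fin.le_def] at this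
        omega
      have := hB k
      rw [← hne, degree_scaleExponent, hweight]
      omega

end WeightedSubstitution

/-! ### The bound on the degree of regularity -/

theorem mainTheorem1 {K : Type*} [Field K] (n : ℕ) (W D : Fin (n + 1) → ℕ)
    (hW : ∀ i, 0 < W i)
    (hD : IsStronglyCompatible W D)
    (hDW : ∀ j : Fin n, W j.castSucc ≤ D j.succ)
    (F : Fin (n + 1) → MvPolynomial (Fin (n + 1)) K)
    (hF : ∀ i, MvPolynomial.IsWeightedHomogeneous W (F i) (D i))
    (hSNP : IsInSimultaneousNoetherPosition F) :
    ∃ r : ℕ, IsWDegreeOfRegularity W F r ∧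
      (r : ℤ) ≤ (∑ i, ((D i : ℤ) - (W i : ℤ))) + (W (Fin.last n) : ℤ) := by
  have hWD := weight_le_degree_of_isInSimultaneousNoetherPosition hW hD hF hSNP
  -- The increment from `j` to `j + 1` is `d_{j+1} - w_j`.
  have hmono : Monotone fun k : Fin (n + 1) => degreeExcess W D (k + 1) + W k := by
    refine Fin.monotone_iff_le_succ.2 fun j => ?_
    have h := degreeExcess_succ W D j.succ
    rw [Fin.val_succ] at h
    have := hDW j
    simp only [Fin.val_castSucc, Fin.val_succ, h]
    omega
  have hexcess : ∀ i, 0 ≤ degreeExcess W D i := fun i =>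
    Finset.sum_nonneg fun j _ => by
      have := hWD j
      omega
  have hlast : degreeExcess W D ((Fin.last n : ℕ) + 1) + W (Fin.last n) =
      ∑ i, ((D i : ℤ) - W i) + W (Fin.last n) := by
    rw [Fin.val_last, degreeExcess_eq_sum]
  obtain ⟨B, hB⟩ := Int.eq_ofNat_of_zero_le
    (add_nonneg (hexcess ((Fin.last n : ℕ) + 1)) (Int.natCast_nonneg (W (Fin.last n))))
  have hkB : ∀ k : Fin (n + 1), degreeExcess W D (k + 1) + W k ≤ B := fun k =>
    hB ▸ hmono (Fin.le_last k)
  have hcomplete : MatrixF5Complete (grevlex (n + 1)) (fun i => homW W (F i)) B := by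
    refine matrixF5Complete_of_leadingMonomials (fun i => isHomogeneous_homW (hF i)) (fun i => ?_)
      (exists_leadingMonomial_degree_le hW hD hF hSNP hkB)
    -- `D i` is within the bound, since `degreeExcess W D (i + 1) + W i = degreeExcess W D i + D i`.
    have h1 := hkB i
    have h2 := degreeExcess_succ W D i
    have h3 := hexcess i
    omega
  refine ⟨sInf {B | MatrixF5Complete (grevlex (n + 1)) (fun i => homW W (F i)) B},
    ⟨Nat.sInf_mem ⟨B, hcomplete⟩, fun _ h => Nat.sInf_le h⟩, ?_⟩
  rw [← hlast, hB]
  exact_mod_cast Nat.sInf_le hcomplete
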